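/- Let $(\Omega,\mathcal F,\mathsf P)$ be a probability space, let $L^0$ be the space of ($\mathsf P$-a.s. classes of) real random variables, and let $\mathcal P$ be the set of probability measures on $\mathcal F$ that are absolutely continuous with respect to $\mathsf P$; measures in $\mathcal P$ are identified with their densities in $L^1(\mathsf P)$. For $\mathsf Q\in\mathcal P$ and $X\in L^0$ put $\mathsf E_{\mathsf Q}X=\mathsf E_{\mathsf Q}X^+-\mathsf E_{\mathsf Q}X^-\in[-\infty,\infty]$ with the convention $\infty-\infty=-\infty$. Let $u:L^0\to[-\infty,\infty]$ be a coherent utility function, i.e. $u(X)=\inf_{\mathsf Q\in\mathcal D'}\mathsf E_{\mathsf Q}X$ for all $X\in L^0$ and some nonempty $\mathcal D'\subseteq\mathcal P$. Assume that its determining set $\mathcal D$, i.e. the largest set $\mathcal D'$ with this property, is weakly compact (compact in the weak topology of $L^1(\mathsf P)$). Let $$L^1_s(\mathcal D)=\Bigl\{X\in L^0:\ \lim_{n\to\infty}\sup_{\mathsf Q\in\mathcal D}\mathsf E_{\mathsf Q}|X|I(|X|>n)=0\Bigr\},$$ and, for $B\subseteq L^0$, let $\mathcal R(B)=\{\mathsf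 Q\in\mathcal P:\ \mathsf E_{\mathsf Q}X\le 0\text{ for all }X\in B\}$. Let $A\subseteq L^0$ be a convex cone (containing $0$) that is $\mathcal D$-consistent, i.e. there is a set $A'\subseteq L^1_s(\mathcal D)\cap A$ with $\mathcal D\cap\mathcal R(A)=\mathcal D\cap\mathcal R(A')$, and let $W\in L^1_s(\mathcal D)$. Write $\mathcal R=\mathcal R(A)$. Then $$\sup_{X\in A}u(W+X)=\inf_{\mathsf Q\in\mathcal D\cap\mathcal R}\mathsf E_{\mathsf Q}W,$$ where $\inf\emptyset:=\infty$. -/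

import Mathlib

open MeasureTheory Filter Topology

namespace CoherentUtility

noncomputable section

variable {Ω : Type*} [MeasurableSpace Ω]

/-- The expectation `E_Q X = E_Q X⁺ - E_Q X⁻ ∈ [-∞, ∞]` of a random variable `X ∈ L⁰(P)`, with the
convention `∞ - ∞ = -∞` (which is the convention of subtraction in `EReal`, see
`top_sub_top_eq_bot`). For `Q ≪ P` it does not depend on the representative of `X`. -/
def extExp {P : Measure Ω} (Q : Measure Ω) (X : Ω →ₘ[P] ℝ) : EReal :=
  ((∫⁻ ω, ENNReal.ofReal (X ω) ∂Q : ENNReal) : EReal) -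
    ((∫⁻ ω, ENNReal.ofReal (-(X ω)) ∂Q : ENNReal) : EReal)

theorem top_sub_top_eq_bot : (⊤ : EReal) - ⊤ = ⊥ := EReal.sub_top ⊤

/-- The set `𝒫` of the probability measures that are absolutely continuous with respect to `P`. -/
def acProb (P : Measure Ω) : Set (Measure Ω) :=
  {Q | IsProbabilityMeasure Q ∧ Q ≪ P}

/-- `u(X) = inf_{Q ∈ 𝒟} E_Q X` for all `X ∈ L⁰`, where `𝒟` is a nonempty subset of `𝒫`. -/
def Represents (P : Measure Ω) (D : Set (Measure Ω)) (u : (Ω →ₘ[P] ℝ) → EReal) : Prop :=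
  D.Nonempty ∧ D ⊆ acProb P ∧ ∀ X : Ω →ₘ[P] ℝ, u X = ⨅ Q ∈ D, extExp Q X

/-- A coherent utility function on `L⁰`. -/
def IsCoherentUtility (P : Measure Ω) (u : (Ω →ₘ[P] ℝ) → EReal) : Prop :=
  ∃ D : Set (Measure Ω), Represents P D u

/-- `D` is the determining set of `u`: the largest set that represents `u`. -/
def IsDeterminingSet (P : Measure Ω) (u : (Ω →ₘ[P] ℝ) → EReal) (D : Set (Measure Ω)) : Prop :=
  IsGreatest {D' : Set (Measure Ω) | Represents P D' u} D

/-- The set of the densities `dQ/dP ∈ L¹(P)` of the measures `Q ∈ D`. -/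
def densities (P : Measure Ω) (D : Set (Measure Ω)) : Set (Lp ℝ 1 P) :=
  {Z | ∃ Q ∈ D, Z =ᵐ[P] fun ω => (Q.rnDeriv P ω).toReal}

/-- `D`, identified with its set of densities, is compact in the weak topology of `L¹(P)`. -/
def IsWeaklyCompact (P : Measure Ω) (D : Set (Measure Ω)) : Prop :=
  IsCompact (toWeakSpace ℝ (Lp ℝ 1 P) '' densities P D)

/-- The strong `L¹`-space of `D`: those `X ∈ L⁰` for which
`sup_{Q ∈ D} E_Q |X| 1_{|X| > n} → 0` as `n → ∞`. -/
def strongL1 (P : Measure Ω) (D : Set (Measure Ω)) : Set (Ω →ₘ[P] ℝ) :=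
  {X | Tendsto (fun n : ℕ => ⨆ Q ∈ D,
      ∫⁻ ω in {ω | (n : ℝ) < |X ω|}, ENNReal.ofReal |X ω| ∂Q) atTop (𝓝 0)}

/-- The set `ℛ(A)` of risk-neutral measures: those `Q ∈ 𝒫` with `E_Q X ≤ 0` for all `X ∈ A`. -/
def riskNeutral (P : Measure Ω) (A : Set (Ω →ₘ[P] ℝ)) : Set (Measure Ω) :=
  {Q | Q ∈ acProb P ∧ ∀ X ∈ A, extExp Q X ≤ 0}

/-- `A` is `D`-consistent: `D ∩ ℛ(A) = D ∩ ℛ(A')` for some `A' ⊆ L¹_s(D) ∩ A`. -/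
def IsConsistent (P : Measure Ω) (D : Set (Measure Ω)) (A : Set (Ω →ₘ[P] ℝ)) : Prop :=
  ∃ A' ⊆ strongL1 P D ∩ A, D ∩ riskNeutral P A = D ∩ riskNeutral P A'

end

end CoherentUtility

/-! For `≤`: if `Q` lies in `D ∩ ℛ` and `X ∈ A`, then `E_Q X ≤ 0` and `W` is `Q`-integrable, so `E_Q
(W + X) ≤ E_Q W` (`extExp_add_le`).

For `≥`, fix a real `c` below the right-hand side. Each `Q ∈ D` has some `X ∈ A ∩ L¹_s(D)` and `t ≥
0` with `E_Q (W + tX) > c`: take `t = 0` if `Q ∈ ℛ`, and otherwise use consistency to get `E_Q X >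
0` and take `t` large. These expectations are weakly continuous on `D`
(`continuousOn_densityIntegral`), so by compactness finitely many pairs suffice. Since `D` is convex
by maximality, the vectors of the finitely many expectations form a compact convex set. Separating
it from an orthant yields one convex combination that exceeds `c` for every `Q ∈ D`; it is again `W
+ X` with `X` in the cone `A`. -/

namespace CoherentUtility

open scoped NNReal ENNReal

/-! ### Separation in finite dimension and reduction to finitely many functions -/

section Minimax

/-- A finite-dimensional minimax lemma: if every point of a nonempty compact convex set has a
coordinate above `c`, then some fixed convex combination of the coordinates is above `c`. -/
theorem exists_convexCombination_gt {ι : Type*} [Fintype ι] {K : Set (ι → ℝ)}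
    (hconv : Convex ℝ K) (hcomp : IsCompact K) (hne : K.Nonempty) {c : ℝ}
    (h : ∀ x ∈ K, ∃ i, c < x i) :
    ∃ w : ι → ℝ, (∀ i, 0 ≤ w i) ∧ ∑ i, w i = 1 ∧ ∀ x ∈ K, c < ∑ i, w i * x i := by
  classical
  let T : Set (ι → ℝ) := Set.Iic fun _ => c
  have hdisj : Disjoint K T := by
    refine Set.disjoint_left.2 fun x hx hxT => ?_
    obtain ⟨i, hi⟩ := h x hx
    exact absurd (hxT i) (not_le.2 hi)
  obtain ⟨f, a, b, hfK, hab, hfT⟩ :=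
    geometric_hahn_banach_compact_closed hconv hcomp (convex_Iic _) isClosed_Iic hdisj
  let e : ι → ℝ := fun i => f (Pi.single i 1)
  have hf : ∀ x : ι → ℝ, f x = ∑ i, x i * e i := by
    intro x
    conv_lhs => rw [pi_eq_sum_univ' x]
    simp [e, map_sum]
  have hcT : b < c * ∑ i, e i := by
    have := hfT (fun _ => c) (Set.mem_Iic.2 le_rfl)
    rwa [hf, ← Finset.mul_sum] at this
  have he : ∀ i, e i ≤ 0 := by
    intro i
    by_contra! hi
    -- Moving from the corner of the orthant by `-t` along axis `i` brings `f` down to exactly `b`,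
    -- its strict lower bound there.
    let t : ℝ := (c * ∑ j, e j - b) / e i
    have ht : 0 ≤ t := div_nonneg (by linarith) hi.le
    have hmem : ((fun _ => c) - t • Pi.single i (1 : ℝ) : ι → ℝ) ∈ T := by
      refine Set.mem_Iic.2 fun j => ?_
      have : (0 : ℝ) ≤ (Pi.single i (1 : ℝ) : ι → ℝ) j := by
        by_cases hj : j = i
        · subst hj; simp
        · simp [hj]
      simpa using mul_nonneg ht this
    have h1 := hfT _ hmem
    have h2 : f (fun _ => c) = c * ∑ j, e j := by rw [hf, ← Finset.mul_sum]
    rw [map_sub, map_smul, smul_eq_mul, h2] at h1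
    have h3 : t * e i = c * ∑ j, e j - b := div_mul_cancel₀ _ hi.ne'
    change b < _ - t * e i at h1
    linarith
  -- Otherwise `f = 0`, which cannot strictly separate two nonempty sets.
  have hS : 0 < -∑ i, e i := by
    refine lt_of_le_of_ne (neg_nonneg.2 (Finset.sum_nonpos fun i _ => he i)) fun h0 => ?_
    have h0' : ∑ i, e i = 0 := by linarith
    have hz : ∀ i, e i = 0 := fun i =>
      (Finset.sum_eq_zero_iff_of_nonpos fun i _ => he i).1 h0' i (Finset.mem_univ i)
    obtain ⟨x, hx⟩ := hne
    have := hfK x hx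
    rw [hf] at this
    simp only [hz, mul_zero, Finset.sum_const_zero] at this hcT
    linarith
  refine ⟨fun i => -e i / -∑ i, e i, fun i => div_nonneg (neg_nonneg.2 (he i)) hS.le, ?_, ?_⟩
  · rw [← Finset.sum_div, Finset.sum_neg_distrib, div_self hS.ne']
  · intro x hx
    have h1 := hfK x hx
    rw [hf] at h1
    have h2 : ∑ i, -e i / (-∑ i, e i) * x i = (-∑ i, x i * e i) / -∑ i, e i := by
      generalize -∑ i, e i = S
      rw [← Finset.sum_neg_distrib, Finset.sum_div]
      exact Finset.sum_congr rfl fun i _ => by ring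
    rw [h2, lt_div_iff₀ hS]
    linarith

theorem exists_finset_forall_exists_gt {E J : Type*} [TopologicalSpace E] {S : Set E}
    (hS : IsCompact S) {f : J → E → ℝ} (hf : ∀ j, ContinuousOn (f j) S) {c : ℝ}
    (h : ∀ x ∈ S, ∃ j, c < f j x) : ∃ t : Finset J, ∀ x ∈ S, ∃ j ∈ t, c < f j x := by
  classical
  rcases S.eq_empty_or_nonempty with rfl | ⟨x₀, hx₀⟩
  · exact ⟨∅, by simp⟩
  have : Nonempty J := ⟨(h x₀ hx₀).choose⟩
  have h' : ∀ x, ∃ j, x ∈ S → c < f j x := fun x => by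
    by_cases hx : x ∈ S
    · exact (h x hx).imp fun j hj _ => hj
    · exact ⟨Classical.arbitrary J, fun hx' => absurd hx' hx⟩
  choose j hj using h'
  obtain ⟨t, -, hst⟩ := hS.elim_nhdsWithin_subcover (fun x => {y | c < f (j x) y})
    fun x hx => (hf (j x) x hx).eventually_const_lt (hj x hx)
  refine ⟨t.image j, fun x hx => ?_⟩
  obtain ⟨y, hy, hxy⟩ := Set.mem_iUnion₂.1 (hst hx)
  exact ⟨j y, Finset.mem_image_of_mem j hy, hxy⟩

end Minimax

/-! ### Extended expectations -/

section ExtendedExpectation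

variable {Ω : Type*} [MeasurableSpace Ω] {P Q : Measure Ω}

/-- Removes the subtraction, so that inequalities for two measures can be scaled and added. The
condition `n ≠ ∞` encodes `∞ - ∞ = -∞`. -/
theorem coe_le_coe_sub_coe_iff (r : ℝ) (p n : ℝ≥0∞) :
    (r : EReal) ≤ (p : EReal) - (n : EReal) ↔
      n ≠ ∞ ∧ n + ENNReal.ofReal r ≤ p + ENNReal.ofReal (-r) := by
  rcases eq_or_ne n ∞ with rfl | hn
  · simp
  rcases eq_or_ne p ∞ with rfl | hp
  · lift n to ℝ≥0 using hn
    have : (⊤ : EReal) - ((n : ℝ≥0∞) : EReal) = ⊤ := EReal.top_sub_coe (n : ℝ)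
    simp [this]
  lift n to ℝ≥0 using hn
  lift p to ℝ≥0 using hp
  have h1 : ((p : ℝ≥0∞) : EReal) - ((n : ℝ≥0∞) : EReal) = (((p : ℝ) - (n : ℝ) : ℝ) : EReal) := by
    rw [EReal.coe_sub]; rfl
  rw [h1, EReal.coe_le_coe_iff]
  simp only [ne_eq, ENNReal.coe_ne_top, not_false_eq_true, true_and, ENNReal.ofReal]
  rw [← ENNReal.coe_add, ← ENNReal.coe_add, ENNReal.coe_le_coe, ← NNReal.coe_le_coe]
  simp only [NNReal.coe_add, Real.coe_toNNReal']
  have : max r 0 - max (-r) 0 = r := max_zero_sub_max_neg_zero_eq_self r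
  constructor <;> intro h <;> linarith

/-- The extended expectation is quasi-concave in the measure. -/
theorem le_extExp_convexCombination {Q₁ Q₂ : Measure Ω} {a b : ℝ≥0} (hab : a + b = 1)
    {X : Ω →ₘ[P] ℝ} {m : EReal} (h₁ : m ≤ extExp Q₁ X) (h₂ : m ≤ extExp Q₂ X) :
    m ≤ extExp (a • Q₁ + b • Q₂) X := by
  refine EReal.ge_of_forall_gt_iff_ge.1 fun r hr => ?_
  have h₁' := (coe_le_coe_sub_coe_iff _ _ _).1 (hr.le.trans h₁)
  have h₂' := (coe_le_coe_sub_coe_iff _ _ _).1 (hr.le.trans h₂)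
  refine (coe_le_coe_sub_coe_iff _ _ _).2 ?_
  simp only [lintegral_add_measure, lintegral_smul_measure, ENNReal.smul_def, smul_eq_mul]
  have hab' : (a : ℝ≥0∞) + b = 1 := by exact_mod_cast hab
  refine ⟨ENNReal.add_ne_top.2 ⟨ENNReal.mul_ne_top ENNReal.coe_ne_top h₁'.1,
    ENNReal.mul_ne_top ENNReal.coe_ne_top h₂'.1⟩, ?_⟩
  have key := add_le_add (mul_le_mul_right h₁'.2 (a : ℝ≥0∞)) (mul_le_mul_right h₂'.2 (b : ℝ≥0∞))
  rw [← one_mul (ENNReal.ofReal r), ← one_mul (ENNReal.ofReal (-r)), ← hab']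
  exact le_of_eq_of_le (by ring) (key.trans_eq (by ring))

theorem extExp_eq_integral {X : Ω →ₘ[P] ℝ} (hX : Integrable X Q) :
    extExp Q X = ((∫ ω, X ω ∂Q : ℝ) : EReal) := by
  have h1 : ∫⁻ ω, ENNReal.ofReal (X ω) ∂Q ≠ ∞ := hX.lintegral_lt_top.ne
  have h2 : ∫⁻ ω, ENNReal.ofReal (-X ω) ∂Q ≠ ∞ := hX.neg.lintegral_lt_top.ne
  rw [integral_eq_lintegral_pos_part_sub_lintegral_neg_part hX, EReal.coe_sub,
    EReal.coe_ennreal_toReal h1, EReal.coe_ennreal_toReal h2]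
  rfl

theorem lintegral_neg_part_eq_top_of_extExp_nonpos {X : Ω →ₘ[P] ℝ} (hX : ¬ Integrable X Q)
    (h : extExp Q X ≤ 0) : ∫⁻ ω, ENNReal.ofReal (-X ω) ∂Q = ∞ := by
  by_contra hn
  have hp : ∫⁻ ω, ENNReal.ofReal (X ω) ∂Q ≠ ∞ := by
    intro hp
    unfold extExp at h
    rw [hp] at h
    lift (∫⁻ ω, ENNReal.ofReal (-X ω) ∂Q) to ℝ≥0 using hn with n
    have : (⊤ : EReal) - ((n : ℝ≥0∞) : EReal) = ⊤ := EReal.top_sub_coe (n : ℝ)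
    simp [this] at h
  refine hX ⟨X.stronglyMeasurable.aestronglyMeasurable, ?_⟩
  rw [hasFiniteIntegral_iff_norm]
  have hm := X.stronglyMeasurable.measurable
  calc ∫⁻ ω, ENNReal.ofReal ‖X ω‖ ∂Q
      ≤ ∫⁻ ω, (ENNReal.ofReal (X ω) + ENNReal.ofReal (-X ω)) ∂Q := by
        refine lintegral_mono fun ω => ?_
        rcases le_total 0 (X ω) with h0 | h0
        · rw [Real.norm_of_nonneg h0]; exact le_self_add
        · rw [Real.norm_of_nonpos h0]; exact le_add_self
    _ = _ := lintegral_add_left hm.ennreal_ofReal _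
    _ < ∞ := ENNReal.add_lt_top.2 ⟨lt_top_iff_ne_top.2 hp, lt_top_iff_ne_top.2 hn⟩

theorem coeFn_add_ae_of_absolutelyContinuous (hQ : Q ≪ P) (X Y : Ω →ₘ[P] ℝ) :
    (⇑(X + Y) : Ω → ℝ) =ᵐ[Q] fun ω => X ω + Y ω :=
  hQ.ae_le (AEEqFun.coeFn_add X Y)

/-- If `X` is not integrable, its negative part has infinite integral; the integrable `W` cannot
cancel this, so the left side is `-∞` by the convention. -/
theorem extExp_add_le (hQ : Q ≪ P) {W X : Ω →ₘ[P] ℝ} (hW : Integrable W Q)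
    (hX : extExp Q X ≤ 0) : extExp Q (W + X) ≤ extExp Q W := by
  have hae := coeFn_add_ae_of_absolutelyContinuous hQ W X
  by_cases hXi : Integrable X Q
  · rw [extExp_eq_integral hXi] at hX
    rw [extExp_eq_integral hW, extExp_eq_integral ((hW.add hXi).congr hae.symm),
      integral_congr_ae hae, integral_add hW hXi, EReal.coe_le_coe_iff]
    have : ∫ ω, X ω ∂Q ≤ 0 := by exact_mod_cast hX
    linarith
  · have htop := lintegral_neg_part_eq_top_of_extExp_nonpos hXi hX
    have hle : ∫⁻ ω, ENNReal.ofReal (-X ω) ∂Q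
        ≤ ∫⁻ ω, ENNReal.ofReal (-(W + X) ω) ∂Q + ∫⁻ ω, ENNReal.ofReal (W ω) ∂Q := by
      rw [← lintegral_add_right _ W.stronglyMeasurable.measurable.ennreal_ofReal]
      refine lintegral_mono_ae (hae.mono fun ω hω => ?_)
      refine le_trans (ENNReal.ofReal_le_ofReal ?_) ENNReal.ofReal_add_le
      rw [hω]; linarith
    rw [htop, top_le_iff, ENNReal.add_eq_top, or_iff_left hW.lintegral_lt_top.ne] at hle
    unfold extExp
    rw [hle]
    simp

theorem integrable_linearCombination {ι : Type*} (hQ : Q ≪ P) {W : Ω →ₘ[P] ℝ}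
    (hW : Integrable W Q) {X : ι → Ω →ₘ[P] ℝ} (hX : ∀ i, Integrable (X i) Q) (w : ι → ℝ)
    (s : Finset ι) :
    Integrable (⇑(W + ∑ i ∈ s, w i • X i)) Q ∧
      ∫ ω, (W + ∑ i ∈ s, w i • X i) ω ∂Q = ∫ ω, W ω ∂Q + ∑ i ∈ s, w i * ∫ ω, X i ω ∂Q := by
  classical
  induction s using Finset.induction_on with
  | empty => simpa using hW
  | insert i s his ih =>
    rw [Finset.sum_insert his, Finset.sum_insert his, add_left_comm]
    have hae := coeFn_add_ae_of_absolutelyContinuous hQ (w i • X i) (W + ∑ i ∈ s, w i • X i)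
    have hsm : (⇑(w i • X i) : Ω → ℝ) =ᵐ[Q] fun ω => w i * X i ω :=
      hQ.ae_le (AEEqFun.coeFn_smul (w i) (X i))
    have hi : Integrable (⇑(w i • X i)) Q := ((hX i).const_mul (w i)).congr hsm.symm
    refine ⟨(hi.add ih.1).congr hae.symm, ?_⟩
    rw [integral_congr_ae hae, integral_add hi ih.1, ih.2, integral_congr_ae hsm,
      integral_const_mul]
    ring

end ExtendedExpectation

/-! ### Convexity of the determining set -/

section DeterminingSet

variable {Ω : Type*} [MeasurableSpace Ω] {P : Measure Ω} {u : (Ω →ₘ[P] ℝ) → EReal}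
  {D : Set (Measure Ω)}

theorem convexCombination_mem_acProb {Q₁ Q₂ : Measure Ω} (h₁ : Q₁ ∈ acProb P)
    (h₂ : Q₂ ∈ acProb P) {a b : ℝ≥0} (hab : a + b = 1) : a • Q₁ + b • Q₂ ∈ acProb P := by
  obtain ⟨_, h₁⟩ := h₁
  obtain ⟨_, h₂⟩ := h₂
  refine ⟨⟨?_⟩, ?_⟩
  · simp only [Measure.add_apply, Measure.smul_apply, measure_univ, ENNReal.smul_def,
      smul_eq_mul, mul_one]
    exact_mod_cast hab
  · exact (h₁.smul_left a).add_left (h₂.smul_left b)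

/-- By quasi-concavity, adjoining a mixture to `D` leaves every infimum unchanged, so maximality
puts the mixture in `D`. -/
theorem IsDeterminingSet.convexCombination_mem (hD : IsDeterminingSet P u D)
    {Q₁ Q₂ : Measure Ω} (h₁ : Q₁ ∈ D) (h₂ : Q₂ ∈ D) {a b : ℝ≥0} (hab : a + b = 1) :
    a • Q₁ + b • Q₂ ∈ D := by
  obtain ⟨⟨hne, hsub, hrep⟩, hmax⟩ := hD
  refine hmax (a := insert (a • Q₁ + b • Q₂) D) ⟨Set.insert_nonempty _ _, ?_, fun X => ?_⟩
    (Set.mem_insert _ _)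
  · exact Set.insert_subset (convexCombination_mem_acProb (hsub h₁) (hsub h₂) hab) hsub
  · rw [iInf_insert, ← hrep X, eq_comm, inf_eq_right]
    refine le_extExp_convexCombination hab ?_ ?_
    · exact (hrep X).le.trans (iInf₂_le Q₁ h₁)
    · exact (hrep X).le.trans (iInf₂_le Q₂ h₂)

end DeterminingSet

/-! ### Weak continuity of expectations -/

section StrongL1

variable {Ω : Type*} [MeasurableSpace Ω] {P Q : Measure Ω} {D : Set (Measure Ω)}

theorem integrable_of_mem_strongL1 {Y : Ω →ₘ[P] ℝ} (hY : Y ∈ strongL1 P D) (hQ : Q ∈ D)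
    [IsFiniteMeasure Q] : Integrable Y Q := by
  obtain ⟨n, hn⟩ := (Tendsto.eventually_lt_const ENNReal.zero_lt_top hY).exists
  have hn' := (le_iSup₂ (f := fun (Q : Measure Ω) (_ : Q ∈ D) =>
    ∫⁻ ω in {ω | (n : ℝ) < |Y ω|}, ENNReal.ofReal |Y ω| ∂Q) Q hQ).trans_lt hn
  have hm := Y.stronglyMeasurable.measurable
  have hs : MeasurableSet {ω | (n : ℝ) < |Y ω|} := measurableSet_lt measurable_const hm.norm
  refine ⟨Y.stronglyMeasurable.aestronglyMeasurable, ?_⟩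
  rw [hasFiniteIntegral_iff_norm, ← lintegral_add_compl _ hs]
  refine ENNReal.add_lt_top.2 ⟨hn', ?_⟩
  calc ∫⁻ ω in {ω | (n : ℝ) < |Y ω|}ᶜ, ENNReal.ofReal ‖Y ω‖ ∂Q
      ≤ ∫⁻ _ in {ω | (n : ℝ) < |Y ω|}ᶜ, ENNReal.ofReal n ∂Q :=
        setLIntegral_mono measurable_const fun ω hω => ENNReal.ofReal_le_ofReal (not_lt.1 hω)
    _ < ∞ := by
        rw [setLIntegral_const]
        exact ENNReal.mul_lt_top ENNReal.ofReal_lt_top (measure_lt_top _ _)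

theorem zero_mem_strongL1 (hD : D ⊆ acProb P) : (0 : Ω →ₘ[P] ℝ) ∈ strongL1 P D := by
  refine tendsto_const_nhds.congr fun n => Eq.symm ?_
  simp only [ENNReal.iSup_eq_zero]
  intro Q hQ
  have h0 : (⇑(0 : Ω →ₘ[P] ℝ) : Ω → ℝ) =ᵐ[Q] 0 := (hD hQ).2.ae_le AEEqFun.coeFn_zero
  refine nonpos_iff_eq_zero.1 ((setLIntegral_le_lintegral _ _).trans (le_of_eq ?_))
  exact lintegral_eq_zero_of_ae_eq_zero (h0.mono fun ω hω => by simp [hω])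

/-- The integral of `g` against the measure with density `z`. -/
noncomputable def densityIntegral (P : Measure Ω) (g : Ω → ℝ) (z : WeakSpace ℝ (Lp ℝ 1 P)) : ℝ :=
  ∫ ω, (((toWeakSpace ℝ (Lp ℝ 1 P)).symm z : Lp ℝ 1 P) : Ω → ℝ) ω * g ω ∂P

theorem continuous_densityIntegral {g : Ω → ℝ} (hg : StronglyMeasurable g) {C : ℝ}
    (hC : ∀ ω, ‖g ω‖ ≤ C) : Continuous (densityIntegral P g) := by
  have hint : ∀ Z : Lp ℝ 1 P, Integrable (fun ω => Z ω * g ω) P := fun Z =>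
    (L1.integrable_coeFn Z).mul_bdd hg.aestronglyMeasurable (ae_of_all _ hC)
  let f : Lp ℝ 1 P →ₗ[ℝ] ℝ :=
    { toFun := fun Z => ∫ ω, Z ω * g ω ∂P
      map_add' := fun Z Z' => by
        rw [← integral_add (hint Z) (hint Z')]
        refine integral_congr_ae ((Lp.coeFn_add Z Z').mono fun ω hω => ?_)
        simp only [hω, Pi.add_apply, add_mul]
      map_smul' := fun r Z => by
        rw [RingHom.id_apply, smul_eq_mul, ← integral_const_mul]
        refine integral_congr_ae ((Lp.coeFn_smul r Z).mono fun ω hω => ?_)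
        simp only [hω, Pi.smul_apply, smul_eq_mul, mul_assoc] }
  let F : StrongDual ℝ (Lp ℝ 1 P) := f.mkContinuous C fun Z => by
    rw [L1.norm_eq_integral_norm, ← integral_const_mul]
    refine norm_integral_le_of_norm_le ((L1.integrable_coeFn Z).norm.const_mul C)
      (ae_of_all _ fun ω => ?_)
    rw [norm_mul, mul_comm]
    exact mul_le_mul_of_nonneg_right (hC ω) (norm_nonneg _)
  exact WeakBilin.eval_continuous (topDualPairing ℝ (Lp ℝ 1 P)).flip F

theorem densityIntegral_eq_integral [SigmaFinite P] [SigmaFinite Q] (hQ : Q ≪ P) {Z : Lp ℝ 1 P}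
    (hZ : Z =ᵐ[P] fun ω => (Q.rnDeriv P ω).toReal) (g : Ω → ℝ) :
    densityIntegral P g (toWeakSpace ℝ (Lp ℝ 1 P) Z) = ∫ ω, g ω ∂Q := by
  rw [← integral_rnDeriv_smul hQ]
  refine integral_congr_ae (hZ.mono fun ω hω => ?_)
  simp only [LinearEquiv.symm_apply_apply, hω, smul_eq_mul]

/-- Truncations of `Y` are bounded, hence give weakly continuous integrals; the definition of
`L¹_s(D)` makes these converge uniformly on `D`. -/
theorem continuousOn_densityIntegral [SigmaFinite P] (hD : D ⊆ acProb P) {Y : Ω →ₘ[P] ℝ}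
    (hY : Y ∈ strongL1 P D) :
    ContinuousOn (densityIntegral P Y) (toWeakSpace ℝ (Lp ℝ 1 P) '' densities P D) := by
  have hm := Y.stronglyMeasurable
  have hs : ∀ n : ℕ, MeasurableSet {ω | (n : ℝ) < |Y ω|} := fun n =>
    measurableSet_lt measurable_const hm.measurable.norm
  let g : ℕ → Ω → ℝ := fun n => {ω | (n : ℝ) < |Y ω|}ᶜ.indicator Y
  have hcont : ∀ n, Continuous (densityIntegral P (g n)) := fun n =>
    continuous_densityIntegral (C := n) (hm.indicator (hs n).compl) fun ω => by
      by_cases hω : ω ∈ {ω | (n : ℝ) < |Y ω|}ᶜ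
      · have hle : |Y ω| ≤ n := not_lt.1 hω
        simpa only [g, Set.indicator_of_mem hω, Real.norm_eq_abs] using hle
      · simp [g, Set.indicator_of_notMem hω]
  refine TendstoUniformlyOn.continuousOn (F := fun n => densityIntegral P (g n)) (p := atTop) ?_
    (Frequently.of_forall fun n => (hcont n).continuousOn)
  refine Metric.tendstoUniformlyOn_iff.2 fun ε hε => ?_
  filter_upwards [Tendsto.eventually_lt_const (ENNReal.ofReal_pos.2 hε) hY] with n hn
  rintro _ ⟨Z, ⟨Q, hQ, hZ⟩, rfl⟩
  obtain ⟨_, hQP⟩ := hD hQ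
  have hn' := (le_iSup₂ (f := fun (Q : Measure Ω) (_ : Q ∈ D) =>
    ∫⁻ ω in {ω | (n : ℝ) < |Y ω|}, ENNReal.ofReal |Y ω| ∂Q) Q hQ).trans_lt hn
  have hint := integrable_of_mem_strongL1 hY hQ
  rw [densityIntegral_eq_integral hQP hZ, densityIntegral_eq_integral hQP hZ, Real.dist_eq,
    integral_indicator (hs n).compl, ← integral_add_compl (hs n) hint, add_sub_cancel_right]
  exact (norm_integral_le_lintegral_norm (⇑Y)).trans_lt
    ((ENNReal.lt_ofReal_iff_toReal_lt hn'.ne_top).1 hn')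

theorem exists_mem_densities [SigmaFinite P] (hQ : Q ∈ D) [IsFiniteMeasure Q] :
    ∃ Z ∈ densities P D, Z =ᵐ[P] fun ω => (Q.rnDeriv P ω).toReal := by
  have h : Integrable (fun ω => (Q.rnDeriv P ω).toReal) P := Measure.integrable_toReal_rnDeriv
  exact ⟨h.toL1 _, ⟨Q, hQ, h.coeFn_toL1⟩, h.coeFn_toL1⟩

end StrongL1

/-! ### The two inequalities -/

section Duality

variable {Ω : Type*} [MeasurableSpace Ω] {P : Measure Ω} {u : (Ω →ₘ[P] ℝ) → EReal}
  {D : Set (Measure Ω)}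

theorem utility_add_le_iInf_extExp {W : Ω →ₘ[P] ℝ} (hD : IsDeterminingSet P u D) (hW : W ∈ strongL1 P D)
    {A : Set (Ω →ₘ[P] ℝ)} {X : Ω →ₘ[P] ℝ} (hX : X ∈ A) :
    u (W + X) ≤ ⨅ Q ∈ D ∩ riskNeutral P A, extExp Q W := by
  obtain ⟨⟨-, hsub, hrep⟩, -⟩ := hD
  refine le_iInf₂ fun Q hQ => ?_
  obtain ⟨_, hQP⟩ := hsub hQ.1
  exact ((hrep _).le.trans (iInf₂_le Q hQ.1)).trans
    (extExp_add_le hQP (integrable_of_mem_strongL1 hW hQ.1) (hQ.2.2 X hX))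

/-- If no measure in the weakly compact determining set `D` gives all the shifts `W + X`,
`X ∈ A ∩ L¹_s(D)`, an expectation at most `c`, then some shift has utility at least `c`. -/
theorem exists_le_utility_add [SigmaFinite P] (hD : IsDeterminingSet P u D)
    (hDc : IsWeaklyCompact P D) (A : PointedCone ℝ (Ω →ₘ[P] ℝ)) {W : Ω →ₘ[P] ℝ}
    (hW : W ∈ strongL1 P D) {c : ℝ}
    (h : ∀ Q ∈ D, ∃ X ∈ strongL1 P D ∩ A, ∃ t : ℝ, 0 ≤ t ∧
      c < ∫ ω, W ω ∂Q + t * ∫ ω, X ω ∂Q) :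
    ∃ X ∈ A, (c : EReal) ≤ u (W + X) := by
  obtain ⟨hne, hsub, hrep⟩ := hD.1
  let J := {X : Ω →ₘ[P] ℝ // X ∈ strongL1 P D ∩ A} × ℝ≥0
  let S := toWeakSpace ℝ (Lp ℝ 1 P) '' densities P D
  let f : J → WeakSpace ℝ (Lp ℝ 1 P) → ℝ := fun j z =>
    densityIntegral P W z + j.2 * densityIntegral P j.1.1 z
  have hf : ∀ j, ContinuousOn (f j) S := fun j =>
    (continuousOn_densityIntegral hsub hW).add
      (continuousOn_const.mul (continuousOn_densityIntegral hsub j.1.2.1))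
  let v : J → Measure Ω → ℝ := fun j Q => ∫ ω, W ω ∂Q + j.2 * ∫ ω, j.1.1 ω ∂Q
  have hfv : ∀ Q ∈ D, ∀ Z : Lp ℝ 1 P, (Z =ᵐ[P] fun ω => (Q.rnDeriv P ω).toReal) →
      ∀ j, f j (toWeakSpace ℝ (Lp ℝ 1 P) Z) = v j Q := by
    intro Q hQ Z hZ j
    obtain ⟨_, hQP⟩ := hsub hQ
    simp only [f, v, densityIntegral_eq_integral hQP hZ]
  obtain ⟨t, ht⟩ := exists_finset_forall_exists_gt (c := c) hDc hf <| by
    rintro _ ⟨Z, ⟨Q, hQ, hZ⟩, rfl⟩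
    obtain ⟨X, hX, r, hr, hc⟩ := h Q hQ
    exact ⟨(⟨X, hX⟩, ⟨r, hr⟩), by rw [hfv Q hQ Z hZ]; exact hc⟩
  let K : Set (t → ℝ) := (fun Q j => v j.1 Q) '' D
  -- Compactness of `K` is read off the densities, convexity off the measures.
  have hKS : K = (fun z (j : t) => f j.1 z) '' S := by
    ext x
    constructor
    · rintro ⟨Q, hQ, rfl⟩
      obtain ⟨_, hQP⟩ := hsub hQ
      obtain ⟨Z, hZD, hZ⟩ := exists_mem_densities (P := P) hQ
      exact ⟨_, ⟨Z, hZD, rfl⟩, funext fun j => hfv Q hQ Z hZ j⟩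
    · rintro ⟨_, ⟨Z, ⟨Q, hQ, hZ⟩, rfl⟩, rfl⟩
      exact ⟨Q, hQ, funext fun j => (hfv Q hQ Z hZ j).symm⟩
  have hKc : IsCompact K := by
    rw [hKS]
    exact hDc.image_of_continuousOn (continuousOn_pi.2 fun j => hf j.1)
  have hKconv : Convex ℝ K := by
    rintro _ ⟨Q₁, h₁, rfl⟩ _ ⟨Q₂, h₂, rfl⟩ a b ha hb hab
    lift a to ℝ≥0 using ha
    lift b to ℝ≥0 using hb
    refine ⟨a • Q₁ + b • Q₂, hD.convexCombination_mem h₁ h₂ (by exact_mod_cast hab),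
      funext fun j => ?_⟩
    obtain ⟨_, -⟩ := hsub h₁
    obtain ⟨_, -⟩ := hsub h₂
    have key : ∀ Y ∈ strongL1 P D,
        ∫ ω, Y ω ∂(a • Q₁ + b • Q₂) = a * ∫ ω, Y ω ∂Q₁ + b * ∫ ω, Y ω ∂Q₂ := fun Y hY => by
      rw [integral_add_measure (integrable_of_mem_strongL1 hY h₁).smul_measure_nnreal
        (integrable_of_mem_strongL1 hY h₂).smul_measure_nnreal, integral_smul_nnreal_measure,
        integral_smul_nnreal_measure]
      rfl
    simp only [v, key W hW, key _ j.1.1.2.1, Pi.add_apply, Pi.smul_apply, smul_eq_mul]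
    ring
  obtain ⟨w, hw, hw1, hwK⟩ := exists_convexCombination_gt (c := c) hKconv hKc (hne.image _) <| by
    rw [hKS]
    rintro _ ⟨z, hz, rfl⟩
    obtain ⟨j, hjt, hj⟩ := ht z hz
    exact ⟨⟨j, hjt⟩, hj⟩
  -- The weights sum to `1`, so averaging the `W + tX` keeps coefficient `1` on `W`.
  refine ⟨∑ j : t, (w j * j.1.2) • j.1.1.1, A.sum_mem fun j _ =>
    A.smul_mem (mul_nonneg (hw j) j.1.2.2) j.1.1.2.2, ?_⟩
  rw [hrep]
  refine le_iInf₂ fun Q hQ => ?_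
  obtain ⟨_, hQP⟩ := hsub hQ
  obtain ⟨hint, heq⟩ := integrable_linearCombination hQP (integrable_of_mem_strongL1 hW hQ)
    (X := fun j : t => j.1.1.1) (fun j => integrable_of_mem_strongL1 j.1.1.2.1 hQ)
    (fun j => w j * j.1.2) Finset.univ
  rw [extExp_eq_integral hint, heq, EReal.coe_le_coe_iff]
  refine (hwK _ ⟨Q, hQ, rfl⟩).le.trans_eq ?_
  simp only [v, mul_add, Finset.sum_add_distrib, ← Finset.sum_mul, hw1, one_mul, mul_assoc]

theorem exists_lt_of_lt_iInf_extExp (hsub : D ⊆ acProb P) {A : PointedCone ℝ (Ω →ₘ[P] ℝ)}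
    (hA : IsConsistent P D (A : Set (Ω →ₘ[P] ℝ))) {W : Ω →ₘ[P] ℝ} (hW : W ∈ strongL1 P D) {c : ℝ}
    (hc : (c : EReal) < ⨅ Q ∈ D ∩ riskNeutral P (A : Set (Ω →ₘ[P] ℝ)), extExp Q W)
    {Q : Measure Ω} (hQ : Q ∈ D) :
    ∃ X ∈ strongL1 P D ∩ A, ∃ t : ℝ, 0 ≤ t ∧ c < ∫ ω, W ω ∂Q + t * ∫ ω, X ω ∂Q := by
  obtain ⟨A', hA', hR⟩ := hA
  obtain ⟨_, hQP⟩ := hsub hQ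
  by_cases hQR : Q ∈ riskNeutral P (A : Set (Ω →ₘ[P] ℝ))
  · have hlt := hc.trans_le (iInf₂_le Q ⟨hQ, hQR⟩)
    rw [extExp_eq_integral (integrable_of_mem_strongL1 hW hQ), EReal.coe_lt_coe_iff] at hlt
    exact ⟨0, ⟨zero_mem_strongL1 hsub, A.zero_mem⟩, 0, le_rfl, by simpa using hlt⟩
  · have hQR' : Q ∉ riskNeutral P A' := fun h' =>
      hQR ((Set.ext_iff.1 hR Q).2 ⟨hQ, h'⟩).2
    have : ∃ X ∈ A', 0 < extExp Q X := by
      by_contra! h'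
      exact hQR' ⟨hsub hQ, h'⟩
    obtain ⟨X, hX, hpos⟩ := this
    have hXs := hA' hX
    rw [extExp_eq_integral (integrable_of_mem_strongL1 hXs.1 hQ)] at hpos
    have hpos' : 0 < ∫ ω, X ω ∂Q := by exact_mod_cast hpos
    -- This `t` makes `t * E_Q X` exceed `c - E_Q W` by at least `1`.
    refine ⟨X, hXs, (|c - ∫ ω, W ω ∂Q| + 1) / ∫ ω, X ω ∂Q, by positivity, ?_⟩
    rw [div_mul_cancel₀ _ hpos'.ne']
    linarith [le_abs_self (c - ∫ ω, W ω ∂Q)]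

end Duality

end CoherentUtility

theorem mainTheorem6 {Ω : Type*} [MeasurableSpace Ω] (P : Measure Ω) [IsProbabilityMeasure P]
    (u : (Ω →ₘ[P] ℝ) → EReal) (hu : CoherentUtility.IsCoherentUtility P u)
    (D : Set (Measure Ω)) (hD : CoherentUtility.IsDeterminingSet P u D)
    (hDc : CoherentUtility.IsWeaklyCompact P D)
    (A : PointedCone ℝ (Ω →ₘ[P] ℝ))
    (hA : CoherentUtility.IsConsistent P D (A : Set (Ω →ₘ[P] ℝ)))
    (W : Ω →ₘ[P] ℝ) (hW : W ∈ CoherentUtility.strongL1 P D) :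
    (⨆ X ∈ A, u (W + X)) =
      ⨅ Q ∈ D ∩ CoherentUtility.riskNeutral P (A : Set (Ω →ₘ[P] ℝ)),
        CoherentUtility.extExp Q W := by
  refine le_antisymm (iSup₂_le fun X hX => CoherentUtility.utility_add_le_iInf_extExp hD hW hX) ?_
  -- Testing against real `c` also covers an infimum equal to `⊤`, as when `D ∩ ℛ` is empty.
  refine EReal.ge_of_forall_gt_iff_ge.1 fun c hc => ?_
  obtain ⟨X, hX, hcX⟩ := CoherentUtility.exists_le_utility_add hD hDc A hW fun Q hQ =>
    CoherentUtility.exists_lt_of_lt_iInf_extExp hD.1.2.1 hA hW hc hQ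
  exact hcX.trans (le_iSup₂ (f := fun X (_ : X ∈ A) => u (W + X)) X hX)
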